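/- **Setting.** Fix finite sets: $\mathcal C$ of channels with a distinguished channel $u$, $\mathcal D$ of data symbols containing three distinct symbols $1,\llbracket,\rrbracket$, and $\mathcal A'$ of further actions. Let $\mathcal D_\Box=\mathcal D\cup\{\Box\}$, where $\Box\notin\mathcal D$ is the blank; the action symbols are $c!d$, $c?d$ ($c\in\mathcal C$, $d\in\mathcal D_\Box$) and the elements of $\mathcal A'$ (all distinct), and $\mathcal A_\tau$ is the set of action symbols together with the unobservable action $\tau$. A *transition system* consists of a set of states, a transition relation $s\xrightarrow{a}t$ with labels $a\in\mathcal A_\tau$, an initial state and a set of final states. It has branching degree bounded by $B$ if every state $s$ has at most $B$ outgoing transitions, i.e. pairs $(a,t)$ with $s\xrightarrow{a}t$. A *reactive Turing machine* (RTM) consists of a finite set $S$ of states, a relation $\to\;\subseteq S\times\mathcal D_\Box\times\mathcal A_\tau\times\mathcal D_\Box\times\{L,R\}\times S$, an initial state and a set of final states. Its transition system $\mathcal T(M)$ has as states the configurations (a state and a two-way infinite tape with a head position and finitely many non-blank cells); $(s,d,a,e,m,t)\in\;\to$ yields an $a$-labelled transition from each configuration in state $s$ whose head reads $d$ to the configuration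 in state $t$ obtained by writing $e$ over $d$ and moving the head in direction $m$. The initial configuration is the initial state with the blank tape; a configuration is final iff its state is. The *parallel composition* $[T_1\parallel T_2]_{\{u\}}$ has as states the pairs of states, as initial state the pair of initial states, and as final states the pairs of final states. Its transitions are the transitions of one component, with the other idle, whose label is not of the form $u!d$ or $u?d$, and $\tau$-transitions in which one component performs $u!d$ and the other $u?d$, for the same $d\in\mathcal D_\Box$. Write $\twoheadrightarrow$ and $\to^+$ for the reflexive-transitive and the transitive closure of $\xrightarrow{\tau}$, and $s\xrightarrow{(a)}t$ for "$s\xrightarrow{a}t$, or $a=\tau$ and $s=t$". Transition systems $T_1,T_2$ are *divergence-preserving branching bisimilar*, $T_1\leftrightarrow_b^\Delta T_2$, if there is a relation $\mathcal R$ between their states that relates the initial states, such that $s_1\mathrel{\mathcal R}s_2$ implies the following and the symmetric conditions with the roles of $T_1$ and $T_2$ exchanged: 1. if $s_1\xrightarrow{a}s_1'$, there are $s_2'',s_2'$ with $s_2\twoheadrightarrow s_2''\xrightarrow{(a)}s_2'$, $s_1\mathrel{\mathcal R}s_2''$ and $s_1'\mathrel{\mathcal R}s_2'$; 2. if $s_1$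 is final, there is a final $s_2'$ with $s_2\twoheadrightarrow s_2'$ and $s_1\mathrel{\mathcal R}s_2'$; 3. if $s_1=s_{1,0}\xrightarrow{\tau}s_{1,1}\xrightarrow{\tau}\cdots$ is infinite with $s_{1,i}\mathrel{\mathcal R}s_2$ for all $i$, there is $s_2'$ with $s_2\to^+s_2'$ and $s_{1,i}\mathrel{\mathcal R}s_2'$ for some $i$. Fix injective codings of $\mathcal A_\tau$ and of $\mathcal D_\Box$ as natural numbers, and let $0,1$ code $L,R$. A *Gödel number* of an RTM $M$ is the code, under a standard effective coding of tuples and finite lists of natural numbers, of the number $n$ of states, the initial state, a list of the final states and a list of the transitions of $M$, for some enumeration of the states of $M$ as $0,\dots,n-1$. For a natural number $g$, let $\mathrm{Send}_g$ be the deterministic RTM that outputs the sequence $\llbracket\,1^{g+1}\,\rrbracket$ along channel $u$, symbol by symbol, has no other behaviour, and then halts in its unique final state. **Theorem.** For every natural number $B$ there is an RTM $U_B$ that is universal up to $B$ in the following sense: for every RTM $M$ that has no transition labelled $u!d$ or $u?d$ with $d\in\mathcal D_\Box$ (the channel $u$ being dedicated to the transmission of Gödel numbers) and whose transition system $\mathcal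 T(M)$ has branching degree bounded by $B$, and for every Gödel number $g$ of $M$, $$\mathcal T(M)\;\leftrightarrow_b^\Delta\;[\,\mathcal T(U_B)\parallel\mathcal T(\mathrm{Send}_g)\,]_{\{u\}}.$$ -/

import Mathlib

namespace ReactiveTM

/-- Action symbols: for every channel `c` and tape symbol `d` (where `none : Option D` is the blank)
the actions `c!d` (send) and `c?d` (receive), and further, uninterpreted actions `A`. -/
inductive Action (Chan D A : Type*) where
  | send (c : Chan) (d : Option D)
  | recv (c : Chan) (d : Option D)
  | other (a : A)

/-! ### Labelled transition systems; the label `none` is the unobservable action `τ` -/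

structure LTS.{w, a} (Act : Type a) where
  State : Type w
  step : State → Option Act → State → Prop
  init : State
  final : Set State

namespace LTS

variable {Act : Type*}

/-- The set of outgoing transitions of a state. -/
def out (T : LTS Act) (s : T.State) : Set (Option Act × T.State) :=
  {p | T.step s p.1 p.2}

/-- Every state has at most `B` outgoing transitions. -/
def BranchingBoundedBy (T : LTS Act) (B : ℕ) : Prop :=
  ∀ s, (T.out s).encard ≤ B

def tauStep (T : LTS Act) (s t : T.State) : Prop := T.step s none t

/-- Zero or more `τ`-steps. -/
def tauStar (T : LTS Act) : T.State → T.State → Prop := Relation.ReflTransGen T.tauStep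

/-- One or more `τ`-steps. -/
def tauPlus (T : LTS Act) : T.State → T.State → Prop := Relation.TransGen T.tauStep

/-- An `a`-step, or possibly no step at all if `a = τ`. -/
def optStep (T : LTS Act) (s : T.State) (a : Option Act) (t : T.State) : Prop :=
  T.step s a t ∨ (a = none ∧ s = t)

structure IsBranchingBisimulation (T₁ T₂ : LTS Act) (R : T₁.State → T₂.State → Prop) : Prop where
  step_left : ∀ s₁ s₂, R s₁ s₂ → ∀ a s₁', T₁.step s₁ a s₁' →
    ∃ s₂'' s₂', T₂.tauStar s₂ s₂'' ∧ T₂.optStep s₂'' a s₂' ∧ R s₁ s₂'' ∧ R s₁' s₂'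
  step_right : ∀ s₁ s₂, R s₁ s₂ → ∀ a s₂', T₂.step s₂ a s₂' →
    ∃ s₁'' s₁', T₁.tauStar s₁ s₁'' ∧ T₁.optStep s₁'' a s₁' ∧ R s₁'' s₂ ∧ R s₁' s₂'
  final_left : ∀ s₁ s₂, R s₁ s₂ → s₁ ∈ T₁.final →
    ∃ s₂', T₂.tauStar s₂ s₂' ∧ R s₁ s₂' ∧ s₂' ∈ T₂.final
  final_right : ∀ s₁ s₂, R s₁ s₂ → s₂ ∈ T₂.final →
    ∃ s₁', T₁.tauStar s₁ s₁' ∧ R s₁' s₂ ∧ s₁' ∈ T₁.final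

structure IsDivergencePreserving (T₁ T₂ : LTS Act) (R : T₁.State → T₂.State → Prop) : Prop where
  div_left : ∀ s₁ s₂, R s₁ s₂ → ∀ f : ℕ → T₁.State, f 0 = s₁ →
    (∀ i, T₁.tauStep (f i) (f (i + 1)) ∧ R (f i) s₂) →
    ∃ s₂', T₂.tauPlus s₂ s₂' ∧ ∃ i, R (f i) s₂'
  div_right : ∀ s₁ s₂, R s₁ s₂ → ∀ f : ℕ → T₂.State, f 0 = s₂ →
    (∀ i, T₂.tauStep (f i) (f (i + 1)) ∧ R s₁ (f i)) →
    ∃ s₁', T₁.tauPlus s₁ s₁' ∧ ∃ i, R s₁' (f i)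

/-- Divergence-preserving branching bisimilarity. -/
def DivBranchingBisimilar (T₁ T₂ : LTS Act) : Prop :=
  ∃ R : T₁.State → T₂.State → Prop,
    IsBranchingBisimulation T₁ T₂ R ∧ IsDivergencePreserving T₁ T₂ R ∧ R T₁.init T₂.init

/-- The parallel composition `[T₁ ∥ T₂]_C`: interleaving of the actions that are not communications
along a channel of `C`, and synchronisation, resulting in `τ`, of `c!d` with `c?d` for `c ∈ C`. -/
def par {Chan D A : Type*} (C : Set Chan) (T₁ T₂ : LTS (Action Chan D A)) :
    LTS (Action Chan D A) where
  State := T₁.State × T₂.State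
  step p a q :=
    (¬ ∃ c ∈ C, ∃ d, a = some (.send c d) ∨ a = some (.recv c d)) ∧
    ((T₁.step p.1 a q.1 ∧ p.2 = q.2) ∨ (T₂.step p.2 a q.2 ∧ p.1 = q.1) ∨
      (a = none ∧ ∃ c ∈ C, ∃ d,
        (T₁.step p.1 (some (.send c d)) q.1 ∧ T₂.step p.2 (some (.recv c d)) q.2) ∨
        (T₁.step p.1 (some (.recv c d)) q.1 ∧ T₂.step p.2 (some (.send c d)) q.2)))
  init := (T₁.init, T₂.init)
  final := {p | p.1 ∈ T₁.final ∧ p.2 ∈ T₂.final}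

end LTS

/-! ### Reactive Turing machines -/

/-- A reactive Turing machine with action symbols `Act` and data symbols `D`.
`trans s d a e m t` means: in state `s`, reading `d`, the machine may execute the action `a`
(`none` is `τ`), replace `d` by `e`, move the head in direction `m`, and enter state `t`. -/
structure RTM.{w, a, d} (Act : Type a) (D : Type d) where
  State : Type w
  finite_state : Finite State
  trans : State → Option D → Option Act → Option D → Turing.Dir → State → Prop
  init : State
  final : Set State

namespace RTM

/-- The transition system associated with `M`. Configurations are pairs of a state and a two-way
infinite tape with a head position and finitely many non-blank cells; initially the tape is blank.
(Tape instances equal up to blanks at both ends are identified in Mathlib's `Turing.Tape`.) -/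
def lts {Act D : Type*} (M : RTM Act D) : LTS Act where
  State := M.State × Turing.Tape (Option D)
  step c a c' := ∃ e m, M.trans c.1 c.2.head a e m c'.1 ∧ c'.2 = (c.2.write e).move m
  init := (M.init, Turing.Tape.mk₁ [])
  final := {c | c.1 ∈ M.final}

/-- No transition of `M` is labelled with a communication along the channel `u`. -/
def AvoidsChannel {Chan D A : Type*} (M : RTM (Action Chan D A) D) (u : Chan) : Prop :=
  ∀ s d e m t x,
    ¬ M.trans s d (some (.send u x)) e m t ∧ ¬ M.trans s d (some (.recv u x)) e m t

/-- The direction left is coded by `0`, and right by `1`. -/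
def dirCode : Turing.Dir → ℕ
  | .left => 0
  | .right => 1

/-- `g` is a Gödel number of `M`, relative to codings `cA` of the actions (including `τ`) and `cD` of
the tape symbols as natural numbers: for some enumeration of the states of `M` as `0, …, n - 1`, it is
the code (through the standard pairing and list codings of Mathlib) of the number of states, the
initial state, a list of the final states, and a list of the transitions. -/
def IsGodelNumber {Act D : Type*} (cA : Option Act → ℕ) (cD : Option D → ℕ)
    (M : RTM Act D) (g : ℕ) : Prop :=
  ∃ (n : ℕ) (e : M.State ≃ Fin n) (fs : List ℕ) (ts : List (ℕ × ℕ × ℕ × ℕ × ℕ × ℕ)),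
    (∀ k, k ∈ fs ↔ ∃ s ∈ M.final, k = (e s : ℕ)) ∧
    (∀ k, k ∈ ts ↔ ∃ s d a d' m t, M.trans s d a d' m t ∧
      k = ((e s : ℕ), cD d, cA a, cD d', dirCode m, (e t : ℕ))) ∧
    g = Encodable.encode (n, (e M.init : ℕ), fs, ts)

/-- Every machine over finite alphabets has a Gödel number. -/
theorem exists_isGodelNumber {Act D : Type*} [Finite Act] [Finite D]
    (cA : Option Act → ℕ) (cD : Option D → ℕ) (M : RTM Act D) :
    ∃ g, M.IsGodelNumber cA cD g := by
  classical
  have := M.finite_state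
  obtain ⟨n, ⟨e⟩⟩ := Finite.exists_equiv_fin M.State
  have h1 : {k : ℕ | ∃ s ∈ M.final, k = (e s : ℕ)}.Finite := by
    refine (Set.finite_range (fun s : M.State => (e s : ℕ))).subset ?_
    rintro k ⟨s, -, rfl⟩
    exact ⟨s, rfl⟩
  have h2 : {k : ℕ × ℕ × ℕ × ℕ × ℕ × ℕ | ∃ s d a d' m t, M.trans s d a d' m t ∧
      k = ((e s : ℕ), cD d, cA a, cD d', dirCode m, (e t : ℕ))}.Finite := by
    have hm : (Set.range dirCode).Finite := by
      refine (Set.finite_Iic 1).subset ?_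
      rintro _ ⟨m, rfl⟩
      cases m <;> simp [dirCode]
    have hS := Set.finite_range (fun s : M.State => (e s : ℕ))
    have hA := Set.finite_range cA
    have hD := Set.finite_range cD
    refine (hS.prod (hD.prod (hA.prod (hD.prod (hm.prod hS))))).subset ?_
    rintro k ⟨s, d, a, d', m, t, -, rfl⟩
    exact ⟨⟨s, rfl⟩, ⟨d, rfl⟩, ⟨a, rfl⟩, ⟨d', rfl⟩, ⟨m, rfl⟩, ⟨t, rfl⟩⟩
  exact ⟨_, n, e, h1.toFinset.toList, h2.toFinset.toList, by simp, by simp, rfl⟩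

/-- The deterministic machine that outputs the word `w` along the channel `u`, symbol by symbol,
after which it halts in its unique final state. It never writes a non-blank symbol. -/
def sender {Chan D : Type*} (A : Type*) (u : Chan) (w : List (Option D)) :
    RTM (Action Chan D A) D where
  State := Fin (w.length + 1)
  finite_state := inferInstance
  trans s d a e m t := ∃ i : Fin w.length,
    s = i.castSucc ∧ d = none ∧ a = some (.send u (w.get i)) ∧ e = none ∧ m = .right ∧ t = i.succ
  init := 0
  final := {Fin.last _}

/-- The number `g` in unary: `g + 1` occurrences of `one`, delimited by `lb` and `rb`. -/
def message {D : Type*} (one lb rb : D) (g : ℕ) : List (Option D) :=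
  some lb :: (List.replicate (g + 1) (some one) ++ [some rb])

/-- `U` is universal up to `B` (for machines `M` that do not themselves communicate along the
channel `u`, which is dedicated to the transmission of the Gödel number). -/
def UniversalUpTo.{w, w', c, d, a} {Chan : Type c} {D : Type d} {A : Type a} (u : Chan)
    (one lb rb : D) (cA : Option (Action Chan D A) → ℕ) (cD : Option D → ℕ) (B : ℕ)
    (U : RTM.{w'} (Action Chan D A) D) : Prop :=
  ∀ M : RTM.{w} (Action Chan D A) D, M.AvoidsChannel u → M.lts.BranchingBoundedBy B →
    ∀ g, M.IsGodelNumber cA cD g →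
      LTS.DivBranchingBisimilar M.lts
        (LTS.par {u} U.lts (sender A u (message one lb rb g)).lts)

end RTM

end ReactiveTM

universe w

/-! The universal machine first reads the unary Gödel number and then simulates the coded machine.
In each configuration it computes whether the simulated state is final and which actions are
enabled, and only then offers all these actions together in a single state. No choice may be
resolved silently, so all alternatives must be present at once. The branching bound makes this
possible: at most `B` distinct actions from a finite alphabet leave finitely many menus, and these
fit in the finite control.

Everything between two such essential configurations is deterministic, unobservable, non-final and
finite. Such inert steps can be collapsed without creating or losing divergence.
`divBranchingBisimilar_of_inert` therefore reduces the theorem to a strong step-by-step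
correspondence at essential configurations.

The computation is not programmed by hand. The coded simulation is a computable map from memory to a
pair (output, new memory), hence it has a `ToPartrec.Code`, a stack machine, and finally a
Post–Turing machine over `Bool`, which an RTM can host by `host`. Two adjustments make this chain
reactive: after each run the bounded output is moved from the stack into the finite state by
`readMachine`, and the halted machine can be resumed at any code with the memory left on its stack
by `exists_tm0_simulation`. The result is `exists_computing_rtm`; `exists_universalUpTo` applies it
to `SimState.command`. -/

namespace ReactiveTM

/-! ### Branching bisimilarity up to inert steps -/

namespace LTS

variable {Act : Type*}

/-- The state `s` is not final and its only transition is a `τ`-step to `t`. -/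
def InertStep (T : LTS Act) (s t : T.State) : Prop :=
  s ∉ T.final ∧ T.step s none t ∧ ∀ a t', T.step s a t' → a = none ∧ t' = t

/-- A finite sequence of inert steps. -/
def InertStar (T : LTS Act) : T.State → T.State → Prop :=
  Relation.ReflTransGen T.InertStep

theorem InertStar.tauStar {T : LTS Act} {s t : T.State} (h : T.InertStar s t) : T.tauStar s t :=
  Relation.ReflTransGen.mono (fun _ _ h => h.2.1) _ _ h

/-- Inert steps leave no alternative, so an infinite silent run cannot avoid the end of an inert
path. This is what controls divergence of the second system. -/
theorem InertStar.exists_eq {T : LTS Act} {s k : T.State} (h : T.InertStar s k)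
    (f : ℕ → T.State) (h0 : f 0 = s) (hf : ∀ i, T.tauStep (f i) (f (i + 1))) : ∃ i, f i = k := by
  induction h using Relation.ReflTransGen.head_induction_on generalizing f with
  | refl => exact ⟨0, h0⟩
  | head h₁ _ ih =>
    have h2 := (h₁.2.2 none (f 1) (h0 ▸ hf 0)).2
    obtain ⟨i, hi⟩ := ih (fun i => f (i + 1)) h2 (fun i => hf (i + 1))
    exact ⟨i + 1, hi⟩

/-- A strong correspondence `K` up to inert steps of the second system yields a
divergence-preserving branching bisimulation. -/
theorem divBranchingBisimilar_of_inert {T₁ T₂ : LTS Act} (K : T₁.State → T₂.State → Prop)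
    (hfin : ∀ s k, K s k → (s ∈ T₁.final ↔ k ∈ T₂.final))
    (hl : ∀ s k a s', K s k → T₁.step s a s' →
      ∃ k' k'', T₂.step k a k' ∧ T₂.InertStar k' k'' ∧ K s' k'')
    (hr : ∀ s k a k', K s k → T₂.step k a k' →
      ∃ s' k'', T₁.step s a s' ∧ T₂.InertStar k' k'' ∧ K s' k'')
    (hi : ∃ k, T₂.InertStar T₂.init k ∧ K T₁.init k) : DivBranchingBisimilar T₁ T₂ := by
  -- A state on its way to `k` is related to everything that `K` relates to `k`.
  refine ⟨fun s t => ∃ k, T₂.InertStar t k ∧ K s k, ⟨?_, ?_, ?_, ?_⟩, ⟨?_, ?_⟩, hi⟩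
  · rintro s t ⟨k, htk, hk⟩ a s' hs
    obtain ⟨k', k'', h1, h2, h3⟩ := hl s k a s' hk hs
    exact ⟨k, k', htk.tauStar, Or.inl h1, ⟨k, .refl, hk⟩, ⟨k'', h2, h3⟩⟩
  · rintro s t ⟨k, htk, hk⟩ a t' ht
    rcases Relation.ReflTransGen.cases_head htk with rfl | ⟨m, hm, hmk⟩
    · obtain ⟨s', k'', h1, h2, h3⟩ := hr s _ a t' hk ht
      exact ⟨s, s', .refl, Or.inl h1, ⟨_, .refl, hk⟩, ⟨k'', h2, h3⟩⟩
    · obtain ⟨rfl, rfl⟩ := hm.2.2 a t' ht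
      exact ⟨s, s, .refl, Or.inr ⟨rfl, rfl⟩, ⟨k, htk, hk⟩, ⟨k, hmk, hk⟩⟩
  · rintro s t ⟨k, htk, hk⟩ hs
    exact ⟨k, htk.tauStar, ⟨k, .refl, hk⟩, (hfin s k hk).1 hs⟩
  · rintro s t ⟨k, htk, hk⟩ ht
    rcases Relation.ReflTransGen.cases_head htk with rfl | ⟨m, hm, -⟩
    · exact ⟨s, .refl, ⟨_, .refl, hk⟩, (hfin s _ hk).2 ht⟩
    · exact absurd ht hm.1
  · rintro s t ⟨k, htk, hk⟩ f rfl hf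
    obtain ⟨k', k'', h1, h2, h3⟩ := hl _ k none _ hk (hf 0).1
    exact ⟨k', Relation.TransGen.tail' htk.tauStar h1, 1, k'', h2, h3⟩
  · rintro s t ⟨k, htk, hk⟩ f h0 hf
    -- The run must reach the essential state `k`; its next step there is matched by a genuine step
    -- of the first system.
    obtain ⟨i, rfl⟩ := htk.exists_eq f h0 fun i => (hf i).1
    obtain ⟨s', k'', h1, h2, h3⟩ := hr s _ none _ hk (hf i).1
    exact ⟨s', .single h1, i + 1, k'', h2, h3⟩

end LTS

end ReactiveTM

namespace ReactiveTM

open Turing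

/-! ### Hosting a Post–Turing machine over `Bool` in a reactive Turing machine -/

section Host

variable {Act D Q : Type*} [Inhabited Q]

/-- The coding of bits as tape symbols: `false` is the blank, `true` is `one`. -/
def bitMap (one : D) : PointedMap Bool (Option D) := ⟨fun b => cond b (some one) none, rfl⟩

theorem bitMap_injective (one : D) : Function.Injective (bitMap one) := by
  intro a b h
  cases a <;> cases b <;> first | rfl | cases h

/-- The states of the host: writing the initial word on the tape, running the hosted machine, and
undoing the move to the right that accompanies a write step. -/
inductive HostState (n : ℕ) (S : Set Q)
  | boot (i : Fin (n + 1))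
  | run (q : S)
  | back (q : S)

instance (n : ℕ) (S : Set Q) [Finite S] : Finite (HostState n S) := by
  let f : Fin (n + 1) ⊕ S ⊕ S → HostState n S :=
    Sum.elim .boot (Sum.elim .run .back)
  refine Finite.of_surjective f ?_
  rintro (i | q | q)
  exacts [⟨.inl i, rfl⟩, ⟨.inr (.inl q), rfl⟩, ⟨.inr (.inr q), rfl⟩]

/-- The transitions of the host of `M`; in addition to the behaviour of `M`, the actions `res` may
be performed, without a change of the tape. -/
inductive HostTrans (one : D) (M : TM0.Machine Bool Q) {S : Set Q} (w : List Bool) (q₀ : S)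
    (res : Q → Option Act → Q → Prop) :
    HostState w.length S → Option D → Option Act → Option D → Dir → HostState w.length S → Prop
  | boot {i j : Fin (w.length + 1)} {b : Bool} (h : (i : ℕ) = j + 1) (hb : w[(j : ℕ)]? = some b) :
      HostTrans one M w q₀ res (.boot i) none none (bitMap one b) .left (.boot j)
  | start {i : Fin (w.length + 1)} (h : (i : ℕ) = 0) :
      HostTrans one M w q₀ res (.boot i) none none none .right (.run q₀)
  | move {q q' : S} {b : Bool} {m : Dir} (h : M q b = some ((q' : Q), .move m)) :
      HostTrans one M w q₀ res (.run q) (bitMap one b) none (bitMap one b) m (.run q')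
  | write {q q' : S} {b b' : Bool} (h : M q b = some ((q' : Q), .write b')) :
      HostTrans one M w q₀ res (.run q) (bitMap one b) none (bitMap one b') .right (.back q')
  | back {q : S} (d : Option D) : HostTrans one M w q₀ res (.back q) d none d .left (.run q)
  | resume {q q' : S} {a : Option Act} (h : res q a q') (d : Option D) :
      HostTrans one M w q₀ res (.run q) d a d .right (.back q')

/-- The host of a Post–Turing machine. -/
def host (one : D) (M : TM0.Machine Bool Q) {S : Set Q} (hS : S.Finite) (w : List Bool) (q₀ : S)
    (res : Q → Option Act → Q → Prop) (fin : Set Q) : RTM Act D where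
  State := HostState w.length S
  finite_state := have := hS.to_subtype; inferInstance
  trans := HostTrans one M w q₀ res
  init := .boot (Fin.last _)
  final := {s | ∃ q, s = .run q ∧ (q : Q) ∈ fin}

variable {one : D} {M : TM0.Machine Bool Q} {S : Set Q} {hS : S.Finite} {w : List Bool} {q₀ : S}
  {res : Q → Option Act → Q → Prop} {fin : Set Q}

theorem host_inertStep_back (q : S) (T : Tape (Option D)) :
    (host one M hS w q₀ res fin).lts.InertStep (.back q, T.move .right) (.run q, T) := by
  refine ⟨?_, ⟨_, _, HostTrans.back _, ?_⟩, ?_⟩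
  · rintro ⟨q', h, -⟩
    cases h
  · simp [Tape.write_self]
  · rintro a ⟨t, T'⟩ ⟨e, m, h, h'⟩
    dsimp only at h h'
    generalize hd : (T.move .right).head = d at h
    cases h
    subst hd
    exact ⟨rfl, by rw [h', Tape.write_self, Tape.move_right_left]⟩

/-- Final states and resumptions are attached only to states where `M` halts, so while `M` runs the
host has exactly one transition. A write takes two steps, since an RTM always moves its head. -/
theorem host_inertStar_step
    (hres : ∀ q a q', res q a q' → ∀ b, M q b = none) (hfin : ∀ q ∈ fin, ∀ b, M q b = none)
    {q q' : S} {T T' : Tape Bool}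
    (h : TM0.step M ⟨(q : Q), T⟩ = some ⟨(q' : Q), T'⟩) :
    (host one M hS w q₀ res fin).lts.InertStar (.run q, T.map (bitMap one))
      (.run q', T'.map (bitMap one)) := by
  simp only [TM0.step, Option.map_eq_some_iff] at h
  obtain ⟨⟨p, s⟩, hM, h⟩ := h
  simp only [TM0.Cfg.mk.injEq] at h
  obtain ⟨rfl, rfl⟩ := h
  have hnf : (HostState.run q : HostState w.length S) ∉ (host one M hS w q₀ res fin).final := by
    rintro ⟨q₁, h, h'⟩
    cases h
    rw [hfin _ h' T.head] at hM
    cases hM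
  have key : ∀ {d a e m t}, HostTrans one M w q₀ res (.run q) d a e m t →
      d = bitMap one T.head → a = none ∧
      ((∃ m', s = .move m' ∧ e = d ∧ m = m' ∧ t = .run q') ∨
        ∃ b, s = .write b ∧ e = bitMap one b ∧ m = .right ∧ t = .back q') := by
    intro d a e m t h hd
    cases h with
    | move h =>
      rw [bitMap_injective one hd, hM] at h
      simp only [Option.some.injEq, Prod.mk.injEq] at h
      exact ⟨rfl, .inl ⟨_, h.2, rfl, rfl, by rw [Subtype.ext h.1]⟩⟩
    | write h =>
      rw [bitMap_injective one hd, hM] at h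
      simp only [Option.some.injEq, Prod.mk.injEq] at h
      exact ⟨rfl, .inr ⟨_, h.2, rfl, rfl, by rw [Subtype.ext h.1]⟩⟩
    | resume h =>
      rw [hres _ _ _ h] at hM
      cases hM
  cases s with
  | move m =>
    refine .single ⟨hnf, ⟨bitMap one T.head, m, ?_, ?_⟩, ?_⟩
    · exact (Tape.map_fst (bitMap one) T).symm ▸ HostTrans.move hM
    · dsimp only
      rw [← Tape.map_fst, Tape.write_self, Tape.map_move]
    · rintro a ⟨t, T'⟩ ⟨e, m', h, h'⟩
      dsimp only at h h'
      obtain ⟨rfl, ⟨_, ⟨⟩, rfl, rfl, rfl⟩ | ⟨_, ⟨⟩, -⟩⟩ := key h (Tape.map_fst _ _)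
      rw [h', Tape.write_self, Tape.map_move]
      exact ⟨rfl, rfl⟩
  | write b =>
    refine .head (b := (.back q', (Tape.map (bitMap one) (T.write b)).move .right))
      ⟨hnf, ⟨bitMap one b, .right, ?_, ?_⟩, ?_⟩ (.single (host_inertStep_back _ _))
    · exact (Tape.map_fst (bitMap one) T).symm ▸ HostTrans.write hM
    · dsimp only
      rw [Tape.map_write]
    · rintro a ⟨t, T'⟩ ⟨e, m', h, h'⟩
      dsimp only at h h'
      obtain ⟨rfl, ⟨_, ⟨⟩, -⟩ | ⟨_, ⟨⟩, rfl, rfl, rfl⟩⟩ := key h (Tape.map_fst _ _)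
      rw [h', Tape.map_write]
      exact ⟨rfl, rfl⟩

theorem host_inertStar (hcl : ∀ {q b q' s}, M q b = some (q', s) → q ∈ S → q' ∈ S)
    (hres : ∀ q a q', res q a q' → ∀ b, M q b = none) (hfin : ∀ q ∈ fin, ∀ b, M q b = none)
    {c c' : TM0.Cfg Bool Q} (h : StateTransition.Reaches (TM0.step M) c c') (hc : c.q ∈ S) :
    ∃ hc' : c'.q ∈ S, (host one M hS w q₀ res fin).lts.InertStar
      (.run ⟨c.q, hc⟩, c.Tape.map (bitMap one)) (.run ⟨c'.q, hc'⟩, c'.Tape.map (bitMap one)) := by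
  induction h with
  | refl => exact ⟨hc, .refl⟩
  | @tail d e _ hde ih =>
    obtain ⟨hd, ih⟩ := ih
    have he : e.q ∈ S := by
      obtain ⟨⟨p, s⟩, hM, rfl⟩ := Option.map_eq_some_iff.1 hde
      exact hcl hM hd
    exact ⟨he, ih.trans (host_inertStar_step hres hfin (q := ⟨d.q, hd⟩) (q' := ⟨e.q, he⟩) hde)⟩

theorem cons_default_nil {Γ : Type*} [Inhabited Γ] :
    ListBlank.cons default (ListBlank.mk ([] : List Γ)) = ListBlank.mk [] := by
  refine ListBlank.ext fun i => ?_
  cases i <;> simp [ListBlank.nth_mk]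

/-- The word is written from right to left. In state `boot k` the head is on the blank cell just
left of the letters from index `k` on; the closing move to the right puts it on the first letter. -/
theorem host_inertStar_init : (host one M hS w q₀ res fin).lts.InertStar
    (host one M hS w q₀ res fin).lts.init (.run q₀, (Tape.mk₁ w).map (bitMap one)) := by
  have hnf : ∀ i, (HostState.boot i : HostState w.length S) ∉
      (host one M hS w q₀ res fin).final := by
    rintro i ⟨q, h, -⟩
    cases h
  suffices ∀ (k : ℕ) (hk : k < w.length + 1), (host one M hS w q₀ res fin).lts.InertStar
      (.boot ⟨k, hk⟩, Tape.mk' (ListBlank.mk [])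
        (ListBlank.cons none (ListBlank.mk ((w.drop k).map (bitMap one)))))
      (.run q₀, (Tape.mk₁ w).map (bitMap one)) by
    have h := this w.length (Nat.lt_succ_self _)
    -- For `k = w.length` nothing has been written yet, and the tape is the blank one.
    rw [List.drop_length, List.map_nil] at h
    erw [cons_default_nil] at h
    exact h
  intro k
  induction k with
  | zero =>
    intro hk
    have hT : ((Tape.mk' (ListBlank.mk [])
        (ListBlank.cons none (ListBlank.mk ((w.drop 0).map (bitMap one))))).write none).move .right
        = (Tape.mk₁ w).map (bitMap one) := by
      rw [Tape.write_mk', Tape.move_right_mk', ListBlank.head_cons, ListBlank.tail_cons,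
        Tape.map_mk₁]
      erw [cons_default_nil]
      rfl
    refine .single ⟨hnf _, ⟨none, .right, ?_, ?_⟩, ?_⟩
    · simpa using! HostTrans.start rfl
    · exact hT.symm
    · rintro a ⟨t, T'⟩ ⟨e, m, h, h'⟩
      dsimp only at h h'
      generalize Tape.head (Γ := Option D) _ = d at h
      cases h with
      | boot h => simp at h
      | start => exact ⟨rfl, by rw [h', hT]⟩
  | succ k ih =>
    intro hk
    have hk' : k < w.length := by omega
    have hT : ((Tape.mk' (ListBlank.mk []) (ListBlank.cons none
          (ListBlank.mk ((w.drop (k + 1)).map (bitMap one))))).write (bitMap one w[k])).move .left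
        = Tape.mk' (ListBlank.mk []) (ListBlank.cons none
          (ListBlank.mk ((w.drop k).map (bitMap one)))) := by
      rw [Tape.write_mk', Tape.move_left_mk', List.drop_eq_getElem_cons hk', List.map_cons]
      rfl
    refine .head ⟨hnf _, ⟨bitMap one w[k], .left, ?_, hT.symm⟩, ?_⟩ (ih (by omega))
    · simpa using! HostTrans.boot rfl (List.getElem?_eq_getElem hk')
    · rintro a ⟨t, T'⟩ ⟨e, m, h, h'⟩
      dsimp only at h h'
      generalize Tape.head (Γ := Option D) _ = d at h
      cases h with
      | @boot _ j b h hb =>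
        obtain ⟨j, hj⟩ := j
        obtain rfl : k = j := by simpa using h
        rw [List.getElem?_eq_getElem hk'] at hb
        cases hb
        exact ⟨rfl, by rw [h', hT]⟩
      | start h => simp at h

/-- Where `M` halts, only resumptions remain. The displacement to the right is undone by the inert
step of `back`. -/
theorem host_step_iff {q : S} (hq : ∀ b, M q b = none) {T : Tape (Option D)} {a : Option Act}
    {c : (host one M hS w q₀ res fin).lts.State} :
    (host one M hS w q₀ res fin).lts.step (.run q, T) a c ↔
      ∃ q' : S, res q a q' ∧ c = (.back q', T.move .right) := by
  constructor
  · obtain ⟨t, T'⟩ := c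
    rintro ⟨e, m, h, h'⟩
    dsimp only at h h'
    generalize hd : T.head = d at h
    cases h with
    | move h => rw [hq] at h; cases h
    | write h => rw [hq] at h; cases h
    | @resume _ q' _ h =>
      refine ⟨q', h, ?_⟩
      rw [h', ← hd, Tape.write_self]
  · rintro ⟨q', h, rfl⟩
    exact ⟨_, _, HostTrans.resume h _, by simp [Tape.write_self]⟩

end Host

end ReactiveTM

namespace ReactiveTM

open Turing

/-! ### Compiling a stack machine to a Post–Turing machine over `Bool` -/

/-- Every stack machine with finite support is simulated by a Post–Turing machine over `Bool`, in
such a way that a halting configuration can be resumed at any label. -/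
theorem exists_tm0_simulation {K : Type} [DecidableEq K] [Fintype K] {Γ : K → Type}
    [∀ k, Fintype (Γ k)] {Λ σ : Type} [Inhabited Λ] [Inhabited σ] [Fintype σ]
    (M : Λ → TM2.Stmt Γ Λ σ) (S : Finset Λ) (ss : TM2.Supports M S) :
    ∃ (Q : Type) (_ : Inhabited Q) (N : TM0.Machine Bool Q) (SQ : Set Q)
      (at' : Option Λ → σ → Q) (Rep : (∀ k, List (Γ k)) → Tape Bool → Prop),
      SQ.Finite ∧ (∀ {q b q' s}, N q b = some (q', s) → q ∈ SQ → q' ∈ SQ) ∧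
      (∀ l ∈ S, ∀ v, at' (some l) v ∈ SQ) ∧ (∀ v b, N (at' none v) b = none) ∧
      Function.Injective (at' none) ∧ (∃ w, Rep (fun _ => []) (Tape.mk₁ w)) ∧
      ∀ l v stk T l' v' stk', Rep stk T →
        StateTransition.Reaches (TM2.step M) ⟨l, v, stk⟩ ⟨l', v', stk'⟩ →
        ∃ T', Rep stk' T' ∧ StateTransition.Reaches (TM0.step N) ⟨at' l v, T⟩ ⟨at' l' v', T'⟩ := by
  classical
  obtain ⟨n, enc, dec, enc0, encdec⟩ := TM1to1.exists_enc_dec (Γ := TM2to1.Γ' K Γ)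
  let M₁ := TM2to1.tr M
  let M₂ := TM1to1.tr enc dec M₁
  have s₁ : TM1.Supports M₁ (TM2to1.trSupp M S) := TM2to1.tr_supports M ss
  have s₂ : TM1.Supports M₂ (TM1to1.trSupp M₁ (TM2to1.trSupp M S)) := TM1to1.tr_supports enc dec M₁ s₁
  have s₃ := TM1to0.tr_supports M₂ s₂
  refine ⟨TM1to0.Λ' M₂, inferInstance, TM1to0.tr M₂,
    ↑(TM1to0.trStmts M₂ (TM1to1.trSupp M₁ (TM2to1.trSupp M S))),
    -- The halted state still carries the local store `v`, whence injectivity of `at' none`. The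
    -- tape relation that follows does not mention the label, so a halting tape is a valid starting
    -- tape for any label.
    fun l v => (((l.map TM2to1.Λ'.normal).map TM1to1.Λ'.normal).map M₂, v),
    fun stk T => ∃ L : ListBlank (∀ k, Option (Γ k)),
      (∀ k, L.map (proj k) = ListBlank.mk ((stk k).map some).reverse) ∧
        T = TM1to1.trTape enc0 (Tape.mk' ∅ (TM2to1.addBottom L)),
    Finset.finite_toSet _, fun h hq => s₃.2 h hq, ?_, fun _ _ => rfl, ?_, ?_, ?_⟩
  · intro l hl v
    have h₁ : TM2to1.Λ'.normal l ∈ TM2to1.trSupp M S :=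
      Finset.mem_biUnion.2 ⟨l, hl, Finset.mem_insert_self _ _⟩
    have h₂ : TM1to1.Λ'.normal (TM2to1.Λ'.normal l) ∈ TM1to1.trSupp M₁ (TM2to1.trSupp M S) :=
      Finset.mem_biUnion.2 ⟨_, h₁, Finset.mem_insert_self _ _⟩
    refine Finset.mem_product.2 ⟨?_, Finset.mem_univ _⟩
    exact Finset.some_mem_insertNone.2 (Finset.mem_biUnion.2 ⟨_, h₂, TM1.stmts₁_self⟩)
  · intro v v' h
    exact congrArg Prod.snd h
  -- Empty stacks amount to the bottom marker alone, so the initial word is its bit code.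
  · refine ⟨(enc (true, default)).toList, ListBlank.mk [], fun k => ?_, ?_⟩
    · rw [ListBlank.map_mk]; rfl
    · rw [TM1to1.trTape_mk']
      exact congrArg (fun l => Tape.mk' (ListBlank.mk []) (ListBlank.mk l))
        (List.append_nil (enc (true, default)).toList).symm
  · rintro l v stk T l' v' stk' ⟨L, hL, rfl⟩ h
    obtain ⟨c₁, hc₁, h₁⟩ := StateTransition.tr_reaches (TM2to1.tr_respects M) (.mk L hL) h
    obtain ⟨c₂, rfl, h₂⟩ := StateTransition.tr_reaches
      (TM1to1.tr_respects (enc0 := enc0) dec M₁ encdec) rfl h₁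
    obtain ⟨c₃, rfl, h₃⟩ := StateTransition.tr_reaches (TM1to0.tr_respects M₂) rfl h₂
    obtain ⟨L', hL'⟩ := hc₁
    exact ⟨_, ⟨L', hL', rfl⟩, h₃⟩

end ReactiveTM

namespace ReactiveTM

open Turing StateTransition

/-! ### Continuing a stack machine after it has halted -/

section Lift

variable {K : Type} {Γ : K → Type} {Λ σ τ : Type}

/-- Extend the local store by a component of type `τ`, and replace halting by a jump to the new
label `none`. -/
def liftStmt : TM2.Stmt Γ Λ σ → TM2.Stmt Γ (Option Λ) (σ × τ)
  | .push k f q => .push k (fun v => f v.1) (liftStmt q)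
  | .peek k f q => .peek k (fun v a => (f v.1 a, v.2)) (liftStmt q)
  | .pop k f q => .pop k (fun v a => (f v.1 a, v.2)) (liftStmt q)
  | .load f q => .load (fun v => (f v.1, v.2)) (liftStmt q)
  | .branch f q₁ q₂ => .branch (fun v => f v.1) (liftStmt q₁) (liftStmt q₂)
  | .goto f => .goto fun v => some (f v.1)
  | .halt => .goto fun _ => none

theorem stepAux_liftStmt [DecidableEq K] (q : TM2.Stmt Γ Λ σ) (v : σ) (t : τ)
    (S : ∀ k, List (Γ k)) : TM2.stepAux (liftStmt q) (v, t) S =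
      ⟨some (TM2.stepAux q v S).l, ((TM2.stepAux q v S).var, t), (TM2.stepAux q v S).stk⟩ := by
  induction q generalizing v S with
  | branch f q₁ q₂ ih₁ ih₂ => simp only [liftStmt, TM2.stepAux]; cases f v <;> simp [ih₁, ih₂]
  | _ => simp_all [liftStmt]

theorem supportsStmt_liftStmt {S : Finset Λ} {q : TM2.Stmt Γ Λ σ} (h : TM2.SupportsStmt S q) :
    TM2.SupportsStmt S.insertNone (liftStmt q : TM2.Stmt Γ (Option Λ) (σ × τ)) := by
  induction q <;> simp_all [liftStmt, TM2.SupportsStmt]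

/-- The halting label `none` of `M` becomes the live label `some none`, at which the extended
machine continues. -/
theorem reaches_lift [DecidableEq K] {M : Λ → TM2.Stmt Γ Λ σ}
    {M' : Option Λ → TM2.Stmt Γ (Option Λ) (σ × τ)} (h : ∀ l, M' (some l) = liftStmt (M l))
    (t : τ) {c c' : TM2.Cfg Γ Λ σ} (hc : Reaches (TM2.step M) c c') :
    Reaches (TM2.step M') ⟨some c.l, (c.var, t), c.stk⟩ ⟨some c'.l, (c'.var, t), c'.stk⟩ := by
  induction hc with
  | refl => exact .refl
  | @tail d e _ hde ih =>
    refine ih.tail ?_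
    obtain ⟨- | l, v, S⟩ := d
    · cases hde
    · cases hde
      simp [h, stepAux_liftStmt]

end Lift

/-! ### Reading a bounded number from the main stack after the evaluation of a code -/

open PartrecToTM2

/-- A list of symbols of length at most `B`. -/
abbrev Message (B : ℕ) : Type := {w : List Γ' // w.length ≤ B}

noncomputable instance (B : ℕ) : Fintype (Message B) :=
  have : Finite (Message B) := (List.finite_length_le Γ' B).to_subtype
  Fintype.ofFinite _

/-- The empty message. -/
def Message.nil (B : ℕ) : Message B := ⟨[], Nat.zero_le _⟩

instance (B : ℕ) : Inhabited (Message B) := ⟨Message.nil B⟩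

/-- Add a symbol to a message, unless the message is full. -/
def Message.push {B : ℕ} (w : Message B) (a : Γ') : Message B :=
  if h : w.1.length < B then ⟨a :: w.1, h⟩ else w

theorem Message.foldl_push {B : ℕ} (l : List Γ') (w : Message B)
    (h : w.1.length + l.length ≤ B) : (l.foldl Message.push w).1 = l.reverse ++ w.1 := by
  induction l generalizing w with
  | nil => rfl
  | cons a l ih =>
    rw [List.length_cons] at h
    have hp : (w.push a).1 = a :: w.1 := by
      rw [Message.push, dif_pos (by omega)]
    rw [List.foldl_cons, ih _ (by rw [hp, List.length_cons]; omega), hp]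
    simp

/-- The message that consists of the binary digits of a number. -/
def Message.ofNat (B o : ℕ) : Message B := (trNat o).foldl Message.push (Message.nil B)

/-- The number with the given binary digits, least significant first. -/
def digitsVal : List Γ' → ℕ
  | [] => 0
  | Γ'.bit1 :: l => 2 * digitsVal l + 1
  | _ :: l => 2 * digitsVal l

theorem digitsVal_trNat (n : ℕ) : digitsVal (trNat n) = n := by
  have h : ∀ p : PosNum, digitsVal (trPosNum p) = p := by
    intro p
    induction p with
    | one => rfl
    | bit1 p ih => simp [trPosNum, digitsVal, ih, PosNum.cast_bit1]; omega
    | bit0 p ih => simp [trPosNum, digitsVal, ih, PosNum.cast_bit0]; omega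
  have h' : ∀ m : Num, digitsVal (trNum m) = m := by
    rintro (- | p)
    · rfl
    · exact h p
  rw [trNat, h', Num.to_of_nat]

/-- Within the length bound no digit is dropped: the message is the reversed binary expansion, which
determines the number. -/
theorem Message.ofNat_injOn {B o o' : ℕ} (ho : (trNat o).length ≤ B) (ho' : (trNat o').length ≤ B)
    (h : Message.ofNat B o = Message.ofNat B o') : o = o' := by
  have h₁ := congrArg Subtype.val h
  rw [Message.ofNat, Message.ofNat, Message.foldl_push _ _ (by simpa [Message.nil] using ho),
    Message.foldl_push _ _ (by simpa [Message.nil] using ho')] at h₁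
  have h₂ := List.reverse_injective (List.append_cancel_right h₁)
  rw [← digitsVal_trNat o, h₂, digitsVal_trNat]

/-- The machine that runs a code, and then pops the first number of the result from the main stack,
leaving it in the local store. -/
def readMachine (B : ℕ) :
    Option Λ' → TM2.Stmt (fun _ : K' => Γ') (Option Λ') (Option Γ' × Message B)
  | some l => liftStmt (tr l)
  | none => .pop .main (fun v a => (a, v.2)) <|
      .branch (fun v => natEnd (v.1.getD .cons)) (.load (fun v => (none, v.2)) .halt)
        (.load (fun v => (none, v.2.push (v.1.getD .cons))) (.goto fun _ => none))

theorem readMachine_supports {B : ℕ} {S : Finset Λ'} (h : Supports S S) :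
    TM2.Supports (readMachine B) S.insertNone := by
  refine ⟨Finset.none_mem_insertNone, ?_⟩
  rintro (- | l) hl
  · simp [readMachine, TM2.SupportsStmt]
  · exact supportsStmt_liftStmt (h l (Finset.some_mem_insertNone.1 hl))

theorem reaches_readMachine_none {B : ℕ} (l r : List Γ') (hl : ∀ x ∈ l, natEnd x = false)
    (w : Message B) : Reaches (TM2.step (readMachine B))
      ⟨some none, (none, w), K'.elim (l ++ .cons :: r) [] [] []⟩
      ⟨none, (none, l.foldl Message.push w), K'.elim r [] [] []⟩ := by
  induction l generalizing w with
  | nil =>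
    refine .single ?_
    simp [readMachine, TM2.step, TM2.stepAux]
  | cons a l ih =>
    refine Relation.ReflTransGen.head ?_ (ih (fun x hx => hl x (List.mem_cons_of_mem _ hx)) _)
    have ha := hl a List.mem_cons_self
    cases a <;> first | exact absurd ha (by decide) | simp [readMachine, TM2.step, TM2.stepAux]

/-- The stacks at the end have exactly the form required to start another code on the input `[m]`,
so runs can be chained. -/
theorem reaches_readMachine {B : ℕ} {c : ToPartrec.Code} {v : List ℕ} {o m : ℕ}
    (h : c.eval v = pure [o, m]) : Reaches (TM2.step (readMachine B))
      ⟨some (some (trNormal c Cont'.halt)), (none, Message.nil B), K'.elim (trList v) [] [] []⟩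
      ⟨none, (none, Message.ofNat B o), K'.elim (trList [m]) [] [] []⟩ := by
  have h₁ : halt [o, m] ∈ eval (TM2.step tr) (init c v) := by
    rw [PartrecToTM2.tr_eval, h]
    exact ⟨trivial, rfl⟩
  have h₂ := reaches_lift (M' := readMachine B) (fun _ => rfl) (Message.nil B) (mem_eval.1 h₁).1
  refine Relation.ReflTransGen.trans h₂ ?_
  exact reaches_readMachine_none (trNat o) _ (trNat_natEnd o) _

theorem exists_code_of_computable {F : ℕ → ℕ × ℕ} (hF : Computable F) :
    ∃ c : ToPartrec.Code, ∀ n, c.eval [n] = pure [(F n).1, (F n).2] := by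
  have key : ∀ f : ℕ → ℕ, Computable f → ∃ c : ToPartrec.Code, ∀ n, c.eval [n] = pure [f n] := by
    intro f hf
    obtain ⟨c, hc⟩ := ToPartrec.Code.exists_code (Nat.Partrec'.part_iff₁.2 hf)
    refine ⟨c, fun n => (hc ⟨[n], rfl⟩).trans ?_⟩
    exact map_pure _ _
  obtain ⟨c₁, h₁⟩ := key _ (Computable.fst.comp hF)
  obtain ⟨c₂, h₂⟩ := key _ (Computable.snd.comp hF)
  refine ⟨.cons c₁ c₂, fun n => ?_⟩
  have h : (ToPartrec.Code.cons c₁ c₂).eval [n] =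
      (c₁.eval [n]).bind fun a => (c₂.eval [n]).bind fun b => pure (a.headI :: b) := rfl
  rw [h, h₁, h₂]
  exact (Part.bind_some _ _).trans (Part.bind_some _ _)

end ReactiveTM

namespace ReactiveTM

open Turing StateTransition PartrecToTM2

/-! ### Reactive Turing machines driven by computable functions -/

instance : Fintype K' :=
  ⟨{.main, .rev, .aux, .stack}, by rintro (_ | _ | _ | _) <;> simp⟩

/-- Given computable functions `F j`, there is a reactive Turing machine whose essential
configurations `K o m` have the output `o` and the memory `m`. In such a configuration the actions
offered, each with a command `j`, are determined by `o`; a command `j` leads, by inert steps, to the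
configuration with output and memory `F j m`. -/
theorem exists_computing_rtm {Act D : Type*} (one : D) (N J : ℕ) (F : ℕ → ℕ → ℕ × ℕ)
    (hF : ∀ j, Computable (F j)) (hN : ∀ j m, (F j m).1 < N)
    (menu : ℕ → Option Act → ℕ → Prop) (hmenu : ∀ o a j, menu o a j → j < J) (fin : Set ℕ) :
    ∃ (U : RTM.{0} Act D) (K : ℕ → ℕ → U.lts.State → Prop),
      (∃ k, U.lts.InertStar U.lts.init k ∧ K (F 0 0).1 (F 0 0).2 k) ∧
      (∀ o m k, K o m k → (k ∈ U.lts.final ↔ o ∈ fin)) ∧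
      (∀ o m k a k', K o m k → U.lts.step k a k' → ∃ j, menu o a j ∧
        ∃ k'', U.lts.InertStar k' k'' ∧ K (F j m).1 (F j m).2 k'') ∧
      (∀ o m k a j, K o m k → menu o a j → ∃ k' k'', U.lts.step k a k' ∧
        U.lts.InertStar k' k'' ∧ K (F j m).1 (F j m).2 k'') ∧
      (∀ o m k a k' k'', K o m k → (∀ j j', menu o a j → menu o a j' → j = j') →
        U.lts.step k a k' → U.lts.step k a k'' → k' = k'') := by
  classical
  choose cd hcd using fun j => exists_code_of_computable (hF j)
  -- The machine starts with empty stacks, that is, with input `[]`; `zero'` supplies the argument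
  -- `0`.
  let cd₀ : ToPartrec.Code := .comp (cd 0) .zero'
  have hcd₀ : cd₀.eval [] = pure [(F 0 0).1, (F 0 0).2] := by
    have h : cd₀.eval [] = (ToPartrec.Code.zero'.eval []).bind (cd 0).eval := rfl
    rw [h, ← hcd 0 0]
    exact Part.bind_some _ _
  let S : Finset Λ' := codeSupp cd₀ Cont'.halt ∪
    (Finset.range J).biUnion fun j => codeSupp (cd j) Cont'.halt
  have hS : Supports S S := by
    refine supports_union.2 ⟨codeSupp_supports Finset.subset_union_left, fun q hq => ?_⟩
    obtain ⟨j, hj, hq⟩ := Finset.mem_biUnion.1 hq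
    exact codeSupp_supports ((Finset.subset_biUnion_of_mem
      (fun j => codeSupp (cd j) Cont'.halt) hj).trans Finset.subset_union_right) q hq
  have hS₀ : some (trNormal cd₀ Cont'.halt) ∈ S.insertNone :=
    Finset.some_mem_insertNone.2
      (Finset.mem_union_left _ (codeSupp_self _ _ (trStmts₁_self _)))
  have hSj : ∀ j < J, some (trNormal (cd j) Cont'.halt) ∈ S.insertNone := fun j hj =>
    Finset.some_mem_insertNone.2 (Finset.mem_union_right _
      (Finset.mem_biUnion.2 ⟨j, Finset.mem_range.2 hj, codeSupp_self _ _ (trStmts₁_self _)⟩))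
  -- Room for the digits of every output below `N`, so that the halting state determines the output.
  let B := (Finset.range N).sup fun o => (trNat o).length
  have hB : ∀ o < N, (trNat o).length ≤ B := fun o ho =>
    Finset.le_sup (f := fun o => (trNat o).length) (Finset.mem_range.2 ho)
  obtain ⟨Q, _, M, SQ, at', Rep, hfin, hcl, hat, hhalt, hinj, ⟨w, hw⟩, hsim⟩ :=
    exists_tm0_simulation (readMachine B) S.insertNone (readMachine_supports hS)
  let stk : ℕ → K' → List Γ' := fun m => K'.elim (trList [m]) [] [] []
  let st : ℕ → Q := fun j => at' (some (some (trNormal (cd j) Cont'.halt))) (none, Message.nil B)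
  let ht : ℕ → Q := fun o => at' none (none, Message.ofNat B o)
  let q₀ : SQ := ⟨at' (some (some (trNormal cd₀ Cont'.halt))) (none, Message.nil B),
    hat _ hS₀ _⟩
  let res : Q → Option Act → Q → Prop := fun q a q' =>
    ∃ o < N, ∃ j, menu o a j ∧ q = ht o ∧ q' = st j
  let fn : Set Q := {q | ∃ o < N, o ∈ fin ∧ q = ht o}
  have hres : ∀ q a q', res q a q' → ∀ b, M q b = none := by
    rintro _ a _ ⟨o, -, j, -, rfl, -⟩ b
    exact hhalt _ _
  have hfn : ∀ q ∈ fn, ∀ b, M q b = none := by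
    rintro _ ⟨o, -, -, rfl⟩ b
    exact hhalt _ _
  have hht : ∀ o < N, ∀ o' < N, ht o = ht o' → o = o' := fun o ho o' ho' h =>
    Message.ofNat_injOn (hB o ho) (hB o' ho') (congrArg Prod.snd (hinj h))
  let U := host one M hfin w q₀ res fn
  have hrun : ∀ j, ∀ m T (h : st j ∈ SQ), Rep (stk m) T → ∃ T' h', Rep (stk (F j m).2) T' ∧
      U.lts.InertStar (.run ⟨st j, h⟩, T.map (bitMap one))
        (.run ⟨ht (F j m).1, h'⟩, T'.map (bitMap one)) := by
    intro j m T h hT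
    obtain ⟨T', hT', hr⟩ := hsim _ _ _ _ _ _ _ hT (reaches_readMachine (B := B) (hcd j m))
    obtain ⟨h', hs⟩ := host_inertStar (one := one) (hS := hfin) (w := w) (q₀ := q₀)
      hcl hres hfn hr h
    exact ⟨T', h', hT', hs⟩
  refine ⟨U, fun o m k => o < N ∧ ∃ T h, Rep (stk m) T ∧
    k = (.run ⟨ht o, h⟩, T.map (bitMap one)), ?_, ?_, ?_, ?_, ?_⟩
  · have hnil : (fun _ : K' => ([] : List Γ')) = K'.elim (trList []) [] [] [] := by
      funext k
      cases k <;> rfl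
    rw [hnil] at hw
    obtain ⟨T', hT', hr⟩ := hsim _ _ _ _ _ _ _ hw (reaches_readMachine (B := B) hcd₀)
    obtain ⟨h', hs⟩ := host_inertStar (one := one) (hS := hfin) (w := w) (q₀ := q₀)
      hcl hres hfn hr q₀.2
    exact ⟨_, host_inertStar_init.trans hs, hN _ _, T', h', hT', rfl⟩
  · rintro o m _ ⟨ho, T, h, -, rfl⟩
    constructor
    · rintro ⟨q, hq, o', ho', hf, hq'⟩
      cases hq
      rwa [hht o ho o' ho' hq']
    · intro hf
      exact ⟨_, rfl, o, ho, hf, rfl⟩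
  · rintro o m _ a k' ⟨ho, T, h, hT, rfl⟩ hst
    obtain ⟨⟨q', hq'⟩, ⟨o', ho', j, hm, hoo, rfl⟩, rfl⟩ :=
      (host_step_iff (fun b => hhalt _ b)).1 hst
    obtain rfl := hht o ho o' ho' hoo
    obtain ⟨T', h', hT', hs⟩ := hrun j m T hq' hT
    exact ⟨j, hm, _, .head (host_inertStep_back _ _) hs, hN _ _, T', h', hT', rfl⟩
  · rintro o m _ a j ⟨ho, T, h, hT, rfl⟩ hm
    have hj : st j ∈ SQ := hat _ (hSj j (hmenu o a j hm)) _
    obtain ⟨T', h', hT', hs⟩ := hrun j m T hj hT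
    exact ⟨_, _, (host_step_iff (fun b => hhalt _ b)).2 ⟨⟨st j, hj⟩, ⟨o, ho, j, hm, rfl, rfl⟩, rfl⟩,
      .head (host_inertStep_back _ _) hs, hN _ _, T', h', hT', rfl⟩
  · rintro o m _ a k' k'' ⟨ho, T, h, -, rfl⟩ hdet hst hst'
    obtain ⟨⟨q, hq⟩, ⟨o₁, ho₁, j, hm, hoo, rfl⟩, rfl⟩ := (host_step_iff (fun b => hhalt _ b)).1 hst
    obtain ⟨⟨q', hq'⟩, ⟨o₂, ho₂, j', hm', hoo', rfl⟩, rfl⟩ :=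
      (host_step_iff (fun b => hhalt _ b)).1 hst'
    obtain rfl := hht o ho o₁ ho₁ hoo
    obtain rfl := hht o ho o₂ ho₂ hoo'
    obtain rfl := hdet j j' hm hm'
    rfl

end ReactiveTM

namespace ReactiveTM

/-! ### Computing with codes of configurations -/

/-- Codes of transitions: source state, symbol read, action, symbol written, direction, target. -/
abbrev TransCode : Type := ℕ × ℕ × ℕ × ℕ × ℕ × ℕ

/-- A coded machine (its final states and its transitions) with a coded configuration: the current
state, the tape to the left of the head, and the tape from the head to the right. -/
abbrev SimState : Type := (List ℕ × List TransCode) × ℕ × List ℕ × List ℕ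

namespace SimState

/-- Remove the duplicates from a list. -/
def distinct {α : Type*} [DecidableEq α] (l : List α) : List α := l.foldr List.insert []

theorem mem_distinct {α : Type*} [DecidableEq α] {l : List α} {x : α} :
    x ∈ distinct l ↔ x ∈ l := by
  induction l with
  | nil => rfl
  | cons a l ih =>
    rw [distinct, List.foldr_cons, List.mem_insert_iff, List.mem_cons]
    exact or_congr Iff.rfl ih

theorem nodup_distinct {α : Type*} [DecidableEq α] (l : List α) : (distinct l).Nodup := by
  induction l with
  | nil => exact List.nodup_nil
  | cons a l ih => exact ih.insert

/-- The first element of a list of coded symbols, or the blank `b`. -/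
def headOr (b : ℕ) (l : List ℕ) : ℕ := l.head?.getD b

/-- The distinct transitions that are enabled. -/
def enabled (b : ℕ) (σ : SimState) : List TransCode :=
  distinct (σ.1.2.filter fun t => t.1 = σ.2.1 ∧ t.2.1 = headOr b σ.2.2.2)

/-- Whether the current state is final, and the actions of at most `B` enabled transitions. -/
def output (b B : ℕ) (σ : SimState) : ℕ :=
  -- The successor keeps `0` free as the output of the reading phase.
  Encodable.encode (decide (σ.2.1 ∈ σ.1.1), ((enabled b σ).map fun t => t.2.2.1).take B) + 1

/-- Apply a transition. -/
def apply (b : ℕ) (σ : SimState) (t : TransCode) : SimState :=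
  (σ.1, t.2.2.2.2.2,
    if t.2.2.2.2.1 = 0 then
      (σ.2.2.1.tail, headOr b σ.2.2.1 :: t.2.2.2.1 :: σ.2.2.2.tail)
    else (t.2.2.2.1 :: σ.2.2.1, σ.2.2.2.tail))

/-- Apply the `i`-th enabled transition. -/
def next (b i : ℕ) (σ : SimState) : SimState :=
  ((enabled b σ)[i]?.map (apply b σ)).getD σ

/-- The initial configuration of the machine with a given Gödel number. -/
def load (g : ℕ) : SimState :=
  ((Encodable.decode g : Option (ℕ × ℕ × List ℕ × List TransCode)).map
    fun p => ((p.2.2.1, p.2.2.2), p.2.1, [], [])).getD (([], []), 0, [], [])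

/-- The state with a given code. -/
def ofCode (m : ℕ) : SimState := ((Encodable.decode m : Option SimState)).getD (([], []), 0, [], [])

/-- The output, truncated at `N`, and the code of a state. -/
def response (b B N : ℕ) (σ : SimState) : ℕ × ℕ := (min (output b B σ) N, Encodable.encode σ)

/-- The effect of the commands: `0` starts counting, `1` counts, `2` loads the machine whose Gödel
number has been counted, and `i + 3` performs its `i`-th enabled transition. -/
def command (b B N : ℕ) : ℕ → ℕ → ℕ × ℕ
  | 0, _ => (0, 0)
  | 1, m => (0, m + 1)
  -- The message for `g` contains `g + 1` ones.
  | 2, m => response b B N (load (m - 1))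
  | i + 3, m => response b B N (next b i (ofCode m))

/-- The truncation in `response` gives the bound for every memory, including those that code no
legitimate configuration. -/
theorem command_fst_lt (b B N j m : ℕ) : (command b B N j m).1 < N + 1 := by
  rcases j with _ | _ | _ | j <;> simp [command, response]

/-! ### Primitive recursiveness of the simulation -/

section Primrec

open Primrec

theorem primrec_mem {α : Type*} [Primcodable α] [DecidableEq α] :
    PrimrecRel fun (a : α) (l : List α) => a ∈ l := by
  refine (PrimrecRel.exists_mem_list (R := fun a b : α => a = b) Primrec.eq).comp₂ .right .left
    |>.of_eq ?_
  simp

theorem primrec_distinct {α : Type*} [Primcodable α] [DecidableEq α] :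
    Primrec (distinct : List α → List α) := by
  refine Primrec.list_foldr .id (.const []) (h := fun _ p => List.insert p.1 p.2) ?_
  refine (Primrec.ite (primrec_mem.comp (fst.comp snd) (snd.comp snd)) (snd.comp snd)
    (list_cons.comp (fst.comp snd) (snd.comp snd))).of_eq ?_
  rintro ⟨_, a, l⟩
  simp [List.insert]

theorem primrec_headOr (b : ℕ) : Primrec (headOr b) :=
  option_getD.comp list_head? (.const b)

theorem primrec_enabled (b : ℕ) : Primrec (enabled b) := by
  have h : PrimrecRel fun (t : TransCode) (p : ℕ × ℕ) => t.1 = p.1 ∧ t.2.1 = p.2 :=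
    PrimrecPred.and (Primrec.eq.comp (fst.comp fst) (fst.comp snd))
      (Primrec.eq.comp (fst.comp (snd.comp fst)) (snd.comp snd))
  exact primrec_distinct.comp ((PrimrecRel.listFilter h).comp (snd.comp fst)
    (Primrec.pair (fst.comp snd) ((primrec_headOr b).comp (snd.comp (snd.comp snd)))))

theorem primrec_output (b B : ℕ) : Primrec (output b B) := by
  refine succ.comp (Primrec.encode.comp (Primrec.pair ?_ ?_))
  · exact (primrec_mem.comp (fst.comp snd) (fst.comp fst)).decide
  · exact list_take.comp (.const B)
      (list_map (primrec_enabled b) (fst.comp (snd.comp (snd.comp snd))))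

theorem primrec_apply (b : ℕ) : Primrec₂ (apply b) := by
  have t : Primrec fun p : SimState × TransCode => p.2 := snd
  have e := fst.comp (snd.comp (snd.comp (snd.comp t)))
  have d := fst.comp (snd.comp (snd.comp (snd.comp (snd.comp t))))
  have q := snd.comp (snd.comp (snd.comp (snd.comp (snd.comp t))))
  have s : Primrec fun p : SimState × TransCode => p.1 := fst
  have L := fst.comp (snd.comp (snd.comp s))
  have R := snd.comp (snd.comp (snd.comp s))
  exact Primrec.pair (fst.comp s) <| Primrec.pair q <|
    Primrec.ite (Primrec.eq.comp d (.const 0))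
      (Primrec.pair (list_tail.comp L) (list_cons.comp ((primrec_headOr b).comp L)
        (list_cons.comp e (list_tail.comp R))))
      (Primrec.pair (list_cons.comp e L) (list_tail.comp R))

theorem primrec_next (b i : ℕ) : Primrec (next b i) :=
  option_getD.comp (option_map (list_getElem?.comp (primrec_enabled b) (.const i))
    (primrec_apply b)) .id

theorem primrec_load : Primrec load := by
  refine option_getD.comp (option_map Primrec.decode ?_) (.const _)
  exact Primrec.pair (Primrec.pair (fst.comp (snd.comp (snd.comp snd)))
    (snd.comp (snd.comp (snd.comp snd))))
    (Primrec.pair (fst.comp (snd.comp snd)) (.const _))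

theorem primrec_ofCode : Primrec ofCode :=
  option_getD.comp Primrec.decode (.const _)

theorem primrec_response (b B N : ℕ) : Primrec (response b B N) :=
  Primrec.pair (nat_min.comp (primrec_output b B) (.const N)) Primrec.encode

theorem computable_command (b B N j : ℕ) : Computable (command b B N j) := by
  refine Primrec.to_comp ?_
  rcases j with _ | _ | _ | i
  · exact .const _
  · exact Primrec.pair (.const 0) succ
  · exact (primrec_response b B N).comp (primrec_load.comp pred)
  · exact (primrec_response b B N).comp ((primrec_next b i).comp primrec_ofCode)

end Primrec

end SimState

end ReactiveTM

namespace ReactiveTM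

open Turing

/-! ### Parallel composition with the sender -/

section Par

variable {Chan D A : Type*} {u : Chan}

/-- The partner can only send along `u`, which is blocked on its own; synchronisation is excluded
because the first component has nothing but a `τ`-step. -/
theorem LTS.InertStep.par {T₁ T₂ : LTS (Action Chan D A)} {s t : T₁.State} (h : T₁.InertStep s t)
    {x : T₂.State} (hx : ∀ a y, T₂.step x a y → ∃ d, a = some (.send u d)) :
    (LTS.par {u} T₁ T₂).InertStep (s, x) (t, x) := by
  obtain ⟨h₁, h₂, h₃⟩ := h
  refine ⟨fun hf => h₁ hf.1, ⟨by simp, .inl ⟨h₂, rfl⟩⟩, ?_⟩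
  rintro a ⟨t', y⟩ ⟨hu, ⟨hs, hy⟩ | ⟨hs, -⟩ | ⟨-, c, -, d, ⟨hs, -⟩ | ⟨hs, -⟩⟩⟩
  · obtain ⟨rfl, rfl⟩ := h₃ _ _ hs
    exact ⟨rfl, by rw [show x = y from hy]⟩
  · obtain ⟨d, rfl⟩ := hx _ _ hs
    exact absurd ⟨u, rfl, d, .inl rfl⟩ hu
  · cases (h₃ _ _ hs).1
  · cases (h₃ _ _ hs).1

theorem LTS.InertStar.par {T₁ T₂ : LTS (Action Chan D A)} {s t : T₁.State} (h : T₁.InertStar s t)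
    {x : T₂.State} (hx : ∀ a y, T₂.step x a y → ∃ d, a = some (.send u d)) :
    (LTS.par {u} T₁ T₂).InertStar (s, x) (t, x) :=
  Relation.ReflTransGen.lift (fun s => (s, x)) (fun _ _ h => h.par hx) _ _ h

variable {w : List (Option D)}

/-- The configuration of the sender after `i` symbols have been sent. -/
def senderCfg (A : Type*) (u : Chan) (w : List (Option D)) (i : Fin (w.length + 1)) :
    (RTM.sender A u w).lts.State :=
  (i, Tape.mk₁ [])

theorem blank_write_move_right {Γ : Type*} [Inhabited Γ] :
    ((Tape.mk₁ ([] : List Γ)).write default).move .right = Tape.mk₁ [] := by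
  have h : Tape.mk₁ ([] : List Γ) = Tape.mk' (ListBlank.mk []) (ListBlank.mk []) := rfl
  have h' : (Tape.mk₁ ([] : List Γ)).write default = Tape.mk₁ [] := rfl
  rw [h', h, Tape.move_right_mk', ListBlank.head_mk, ListBlank.tail_mk]
  exact congrArg (Tape.mk' · _) cons_default_nil

/-- Moving on a blank tape does not change it as a `Tape`, so the number of symbols sent is the
whole configuration. -/
theorem sender_step_iff {i : Fin (w.length + 1)} {a : Option (Action Chan D A)}
    {c : (RTM.sender A u w).lts.State} :
    (RTM.sender A u w).lts.step (senderCfg A u w i) a c ↔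
      ∃ h : (i : ℕ) < w.length, a = some (.send u w[(i : ℕ)]) ∧
        c = senderCfg A u w ⟨i + 1, by omega⟩ := by
  obtain ⟨t, T⟩ := c
  constructor
  · rintro ⟨e, m, ⟨j, hj, hd, ha, rfl, rfl, ht⟩, hT⟩
    obtain rfl : i = j.castSucc := hj
    refine ⟨j.2, ha, ?_⟩
    have hT' : T = Tape.mk₁ [] := hT.trans blank_write_move_right
    rw [hT']
    exact Prod.ext ht rfl
  · rintro ⟨h, rfl, h'⟩
    obtain ⟨rfl, rfl⟩ := Prod.mk.inj h'
    exact ⟨none, .right, ⟨⟨i, h⟩, rfl, rfl, rfl, rfl, rfl, rfl⟩, blank_write_move_right.symm⟩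

theorem sender_step_send {i : Fin (w.length + 1)} (a : Option (Action Chan D A))
    (c : (RTM.sender A u w).lts.State)
    (h : (RTM.sender A u w).lts.step (senderCfg A u w i) a c) : ∃ d, a = some (.send u d) := by
  obtain ⟨h, rfl, -⟩ := sender_step_iff.1 h
  exact ⟨_, rfl⟩

/-- If the receiver can only receive along `u`, and has at most one transition for the symbol that
is sent next, then receiving this symbol is an inert step. -/
theorem par_sender_inertStep {T : LTS (Action Chan D A)} {s t : T.State} {i : ℕ}
    {x : Option D} (hi : i + 1 < w.length + 1) (hx : w[i]? = some x)
    (hs : ∀ a s', T.step s a s' → ∃ d, a = some (.recv u d))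
    (ht : T.step s (some (.recv u x)) t) (hu : ∀ t', T.step s (some (.recv u x)) t' → t' = t) :
    (LTS.par {u} T (RTM.sender A u w).lts).InertStep
      (s, senderCfg A u w ⟨i, by omega⟩) (t, senderCfg A u w ⟨i + 1, hi⟩) := by
  have hw : i < w.length := by omega
  obtain rfl : w[i] = x := by simpa [List.getElem?_eq_getElem hw] using hx
  refine ⟨?_, ⟨by simp, .inr (.inr ⟨rfl, u, rfl, _, .inr ⟨ht, sender_step_iff.2 ⟨hw, rfl, rfl⟩⟩⟩)⟩, ?_⟩
  · rintro ⟨-, h⟩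
    have h' : (⟨i, by omega⟩ : Fin (w.length + 1)) = Fin.last _ := h
    have := congrArg Fin.val h'
    simp only [Fin.val_last] at this
    omega
  · rintro a ⟨t', y⟩ ⟨hn, ⟨h, -⟩ | ⟨h, -⟩ | ⟨rfl, c, hc, d, ⟨h, -⟩ | ⟨h, h'⟩⟩⟩
    · obtain ⟨d, rfl⟩ := hs _ _ h
      exact absurd ⟨u, rfl, d, .inr rfl⟩ hn
    · obtain ⟨d, rfl⟩ := sender_step_send _ _ h
      exact absurd ⟨u, rfl, d, .inl rfl⟩ hn
    · obtain ⟨d', h'⟩ := hs _ _ h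
      cases h'
    · obtain ⟨h₀, h₁, h₂⟩ := sender_step_iff.1 h'
      cases h₁
      dsimp only at h h₂
      rw [hu _ h, h₂]
      exact ⟨rfl, rfl⟩

end Par

/-! ### Branching degree -/

/-- If the transition system of `M` has branching degree bounded by `B`, then `M` has at most `B`
transitions for every state and every symbol read. -/
theorem RTM.encard_trans_le {Act D : Type*} (one : D) {M : RTM Act D} {B : ℕ}
    (h : M.lts.BranchingBoundedBy B) (s : M.State) (d : Option D) :
    {p : Option Act × Option D × Dir × M.State | M.trans s d p.1 p.2.1 p.2.2.1 p.2.2.2}.encard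
      ≤ B := by
  -- Distinct transitions may lead to the same configuration: on a blank tape, writing a blank and
  -- moving left or right agree. The single mark at position 3 breaks this symmetry.
  let T : Tape (Option D) :=
    Tape.mk' (ListBlank.mk []) (ListBlank.mk [d, none, none, some one])
  refine le_trans (Set.encard_le_encard_of_injOn
    (f := fun p => (p.1, (p.2.2.2, (T.write p.2.1).move p.2.2.1))) ?_ ?_) (h (s, T))
  · rintro ⟨a, e, m, t⟩ hp
    exact ⟨e, m, hp, rfl⟩
  · rintro ⟨a, e, m, t⟩ - ⟨a', e', m', t'⟩ - hp
    simp only [Prod.mk.injEq] at hp ⊢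
    obtain ⟨rfl, rfl, hT⟩ := hp
    have h1 : T.nth 1 = none := Tape.mk'_nth_nat _ _ 1
    have h3 : T.nth 3 = some one := Tape.mk'_nth_nat _ _ 3
    -- Position 2 shows the mark exactly after a move to the right; the written symbol is then at
    -- `-1`, and otherwise at `1`.
    have n2 : (Tape.move m (T.write e)).nth 2 = (Tape.move m' (T.write e')).nth 2 := by rw [hT]
    have n1 : (Tape.move m (T.write e)).nth 1 = (Tape.move m' (T.write e')).nth 1 := by rw [hT]
    have n0 : (Tape.move m (T.write e)).nth (-1) = (Tape.move m' (T.write e')).nth (-1) := by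
      rw [hT]
    have hw : ∀ e, (T.write e).head = e := fun _ => rfl
    clear hT
    cases m <;> cases m' <;>
      simp_all [Tape.move_left_nth, Tape.move_right_nth, Tape.write_nth]

end ReactiveTM

namespace ReactiveTM

open Turing

instance {Chan D A : Type*} [Finite Chan] [Finite D] [Finite A] : Finite (Action Chan D A) := by
  let f : (Chan × Option D) ⊕ (Chan × Option D) ⊕ A → Action Chan D A :=
    Sum.elim (fun p => .send p.1 p.2) (Sum.elim (fun p => .recv p.1 p.2) .other)
  refine Finite.of_surjective f ?_
  rintro (⟨c, d⟩ | ⟨c, d⟩ | a)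
  exacts [⟨.inl (c, d), rfl⟩, ⟨.inr (.inl (c, d)), rfl⟩, ⟨.inr (.inr a), rfl⟩]

/-! ### Correctness of the simulation of a coded machine -/

namespace SimState

section Sim

variable {Act D : Type*} {cA : Option Act → ℕ} {cD : Option D → ℕ} {M : RTM Act D} {n : ℕ}

/-- `σ` represents the configuration `c` of the machine `M`. -/
def Represents (cD : Option D → ℕ) (e : M.State ≃ Fin n) (fs : List ℕ) (ts : List TransCode)
    (σ : SimState) (c : M.lts.State) : Prop :=
  ∃ L R : List (Option D), c.2 = Tape.mk' (ListBlank.mk L) (ListBlank.mk R) ∧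
    σ = ((fs, ts), (e c.1 : ℕ), L.map cD, R.map cD)

theorem headOr_map (cD : Option D → ℕ) (L : List (Option D)) :
    headOr (cD none) (L.map cD) = cD (ListBlank.mk L).head := by
  cases L <;> rfl

variable {e : M.State ≃ Fin n} {fs : List ℕ} {ts : List TransCode} {σ : SimState}
  {c : M.lts.State}

theorem mem_enabled (hcD : Function.Injective cD)
    (hts : ∀ k, k ∈ ts ↔ ∃ s d a d' m t, M.trans s d a d' m t ∧
      k = ((e s : ℕ), cD d, cA a, cD d', RTM.dirCode m, (e t : ℕ)))
    (h : Represents cD e fs ts σ c) {k : TransCode} : k ∈ enabled (cD none) σ ↔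
      ∃ a d' m t, M.trans c.1 c.2.head a d' m t ∧
        k = ((e c.1 : ℕ), cD c.2.head, cA a, cD d', RTM.dirCode m, (e t : ℕ)) := by
  obtain ⟨L, R, hc, rfl⟩ := h
  have hd : c.2.head = (ListBlank.mk R).head := by rw [hc, Tape.mk'_head]
  rw [enabled, mem_distinct, List.mem_filter, hts, headOr_map, ← hd]
  constructor
  · rintro ⟨⟨s, d, a, d', m, t, ht, rfl⟩, hk⟩
    simp only [decide_eq_true_eq] at hk
    obtain rfl := e.injective (Fin.ext hk.1)
    obtain rfl := hcD hk.2
    exact ⟨a, d', m, t, ht, rfl⟩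
  · rintro ⟨a, d', m, t, ht, rfl⟩
    exact ⟨⟨_, _, a, d', m, t, ht, rfl⟩, by simp⟩

/-- The list `ts` may repeat a transition; once duplicates are removed, the enabled codes lie in the
image of the transitions of `M` for one state and symbol, of which there are at most `B`. -/
theorem length_enabled_le (one : D) {B : ℕ} (hB : M.lts.BranchingBoundedBy B)
    (hcD : Function.Injective cD)
    (hts : ∀ k, k ∈ ts ↔ ∃ s d a d' m t, M.trans s d a d' m t ∧
      k = ((e s : ℕ), cD d, cA a, cD d', RTM.dirCode m, (e t : ℕ)))
    (h : Represents cD e fs ts σ c) : (enabled (cD none) σ).length ≤ B := by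
  classical
  have h₁ : (enabled (cD none) σ).toFinset.card = (enabled (cD none) σ).length :=
    List.toFinset_card_of_nodup (nodup_distinct _)
  rw [← h₁, ← ENat.natCast_le_natCast, ← Set.encard_coe_eq_coe_finsetCard]
  refine le_trans ?_ (RTM.encard_trans_le one hB c.1 c.2.head)
  refine le_trans (Set.encard_le_encard ?_) (Set.encard_image_le (fun p =>
    (((e c.1 : ℕ), cD c.2.head, cA p.1, cD p.2.1, RTM.dirCode p.2.2.1, (e p.2.2.2 : ℕ)) :
      TransCode)) _)
  intro k hk
  rw [Finset.mem_coe, List.mem_toFinset, mem_enabled hcD hts h] at hk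
  obtain ⟨a, d', m, t, ht, rfl⟩ := hk
  exact ⟨(a, d', m, t), ht, rfl⟩

theorem represents_apply (h : Represents cD e fs ts σ c) (x y : ℕ) (a : ℕ) (d' : Option D)
    (m : Dir) (t : M.State) : Represents cD e fs ts
      (apply (cD none) σ (x, y, a, cD d', RTM.dirCode m, (e t : ℕ)))
      (t, (c.2.write d').move m) := by
  obtain ⟨L, R, hc, rfl⟩ := h
  -- This also covers `R = []`, where the head reads an implicit blank.
  have hw : c.2.write d' = Tape.mk' (ListBlank.mk L) (ListBlank.cons d' (ListBlank.mk R.tail)) := by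
    rw [hc, ← ListBlank.cons_head_tail (ListBlank.mk R), Tape.write_mk', ListBlank.tail_cons,
      ListBlank.tail_mk]
  cases m with
  | left =>
    refine ⟨L.tail, (ListBlank.mk L).head :: d' :: R.tail, ?_, ?_⟩
    · dsimp only
      rw [hw, Tape.move_left_mk', ListBlank.tail_mk, ListBlank.cons_mk, ListBlank.cons_mk]
    · simp [apply, RTM.dirCode, headOr_map, List.map_tail]
  | right =>
    refine ⟨d' :: L, R.tail, ?_, ?_⟩
    · dsimp only
      rw [hw, Tape.move_right_mk', ListBlank.head_cons, ListBlank.tail_cons, ListBlank.cons_mk]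
    · simp [apply, RTM.dirCode, List.map_tail]

theorem represents_load {g : ℕ}
    (hg : g = Encodable.encode (n, (e M.init : ℕ), fs, ts)) :
    Represents cD e fs ts (load g) M.lts.init := by
  refine ⟨[], [], rfl, ?_⟩
  have h : (Encodable.decode g : Option (ℕ × ℕ × List ℕ × List TransCode)) =
      some (n, (e M.init : ℕ), fs, ts) := by
    rw [hg]
    exact Encodable.encodek _
  rw [load, h]
  rfl

theorem ofCode_encode (σ : SimState) : ofCode (Encodable.encode σ) = σ := by
  rw [ofCode, Encodable.encodek]
  rfl

/-- The output in a configuration, given the actions of the enabled transitions. -/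
theorem exists_output_eq (one : D) {B : ℕ} (hB : M.lts.BranchingBoundedBy B)
    (hcD : Function.Injective cD)
    (hfs : ∀ k, k ∈ fs ↔ ∃ s ∈ M.final, k = (e s : ℕ))
    (hts : ∀ k, k ∈ ts ↔ ∃ s d a d' m t, M.trans s d a d' m t ∧
      k = ((e s : ℕ), cD d, cA a, cD d', RTM.dirCode m, (e t : ℕ)))
    (h : Represents cD e fs ts σ c) :
    ∃ (b : Bool) (l : List (Option Act)), l.length ≤ B ∧ (b = true ↔ c ∈ M.lts.final) ∧
      ((enabled (cD none) σ).map fun t => t.2.2.1) = l.map cA ∧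
      output (cD none) B σ = Encodable.encode (b, l.map cA) + 1 := by
  have hl := length_enabled_le one hB hcD hts h
  have hr : ((enabled (cD none) σ).map fun t => t.2.2.1) ∈ Set.range (List.map cA) := by
    rw [Set.range_list_map]
    intro x hx
    obtain ⟨k, hk, rfl⟩ := List.mem_map.1 hx
    obtain ⟨a, d', m, t, -, rfl⟩ := (mem_enabled hcD hts h).1 hk
    exact ⟨a, rfl⟩
  obtain ⟨l, hl'⟩ := hr
  refine ⟨decide (σ.2.1 ∈ σ.1.1), l, ?_, ?_, hl'.symm, ?_⟩
  · rw [← List.length_map cA, hl', List.length_map]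
    exact hl
  · obtain ⟨L, R, -, rfl⟩ := h
    rw [decide_eq_true_eq, hfs]
    constructor
    · rintro ⟨s, hs, hs'⟩
      obtain rfl := e.injective (Fin.ext hs')
      exact hs
    · intro hs
      exact ⟨_, hs, rfl⟩
  · rw [output, List.take_of_length_le (by rw [List.length_map]; exact hl), hl']

end Sim

end SimState

/-- There are finitely many lists of at most `B` actions, so the bound on outputs can be chosen
before the simulated machine is known. -/
theorem exists_output_bound {Act : Type*} [Finite Act] (cA : Option Act → ℕ) (B : ℕ) :
    ∃ N : ℕ, ∀ (b : Bool) (l : List (Option Act)), l.length ≤ B →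
      Encodable.encode (b, l.map cA) + 1 ≤ N := by
  have h := ((Set.toFinite (Set.univ : Set Bool)).prod
    (List.finite_length_le (Option Act) B)).image fun p => Encodable.encode (p.1, p.2.map cA) + 1
  obtain ⟨N, hN⟩ := h.bddAbove
  exact ⟨N, fun b l hl => hN ⟨(b, l), ⟨trivial, hl⟩, rfl⟩⟩

end ReactiveTM

namespace ReactiveTM

open Turing SimState

/-! ### The universal machine -/

section Universal

variable {Chan D A : Type*} (u : Chan) (one lb rb : D) (cA : Option (Action Chan D A) → ℕ) (B : ℕ)

/-- The actions offered by the universal machine, with the commands that they trigger, in terms of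
the output: the output `0` asks for the next symbol of the message, and any other output lists the
actions of the simulated machine. -/
inductive Menu : ℕ → Option (Action Chan D A) → ℕ → Prop
  | recvLeft : Menu 0 (some (.recv u (some lb))) 0
  | recvOne : Menu 0 (some (.recv u (some one))) 1
  | recvRight : Menu 0 (some (.recv u (some rb))) 2
  | act (b : Bool) (l : List ℕ) (i : ℕ) (a : Option (Action Chan D A)) (hi : i < B)
      (hl : l[i]? = some (cA a)) : Menu (Encodable.encode (b, l) + 1) a (i + 3)

variable {u one lb rb cA B}

theorem Menu.lt {o j : ℕ} {a : Option (Action Chan D A)} (h : Menu u one lb rb cA B o a j) :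
    j < B + 3 := by
  cases h <;> omega

theorem Menu.recv {a : Option (Action Chan D A)} {o j : ℕ} (h : Menu u one lb rb cA B o a j)
    (ho : o = 0) : ∃ d, a = some (.recv u d) := by
  cases h with
  | act => omega
  | _ => exact ⟨_, rfl⟩

/-- Since the three message symbols differ, the received symbol fixes the command; this makes the
reading phase inert. -/
theorem Menu.det (h₁ : one ≠ lb) (h₂ : one ≠ rb) (h₃ : lb ≠ rb) {a : Option (Action Chan D A)}
    {o o' j j' : ℕ} (h : Menu u one lb rb cA B o a j) (ho : o = 0)
    (h' : Menu u one lb rb cA B o' a j') (ho' : o' = 0) : j = j' := by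
  cases h <;> cases h' <;> first | rfl | contradiction

theorem Menu.exists_index {o j : ℕ} {a : Option (Action Chan D A)}
    (h : Menu u one lb rb cA B o a j) {b : Bool} {l : List ℕ}
    (ho : o = Encodable.encode (b, l) + 1) : ∃ i, j = i + 3 ∧ l[i]? = some (cA a) := by
  cases h with
  | act b' l' i a hi hl =>
    obtain ⟨-, rfl⟩ := Prod.mk.inj (Encodable.encode_injective (Nat.succ_injective ho))
    exact ⟨i, rfl, hl⟩
  | _ => omega

theorem exists_universalUpTo [Finite Chan] [Finite D] [Finite A] (h₁ : one ≠ lb)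
    (h₂ : one ≠ rb) (h₃ : lb ≠ rb) (hcA : Function.Injective cA) {cD : Option D → ℕ}
    (hcD : Function.Injective cD) :
    ∃ U : RTM.{0} (Action Chan D A) D, RTM.UniversalUpTo.{w} u one lb rb cA cD B U := by
  -- `N` and `U` depend only on the alphabets, the codings and `B`, not on `M`.
  obtain ⟨N, hN⟩ := exists_output_bound cA B
  obtain ⟨U, K, ⟨k₀, hk₀, hK₀⟩, hfinal, hstep, hmenu, huniq⟩ :=
    exists_computing_rtm one (N + 1) (B + 3) (command (cD none) B N)
      (fun j => computable_command _ _ _ j) (command_fst_lt _ _ _) (Menu u one lb rb cA B)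
      (fun _ _ _ h => h.lt) {o | ∃ l : List ℕ, o = Encodable.encode (true, l) + 1}
  refine ⟨U, fun M hM hB g hg => ?_⟩
  obtain ⟨n, e, fs, ts, hfs, hts, hg⟩ := hg
  let w := RTM.message one lb rb g
  have hw : w.length = g + 3 := by simp [w, RTM.message]
  -- Essential states: the sender has finished, and `U` presents the menu of a code of `c`. The
  -- finished sender is final and has no transitions, so both finality and steps depend on `U`
  -- alone.
  let KK : M.lts.State → (LTS.par {u} U.lts (RTM.sender A u w).lts).State → Prop := fun c p =>
    ∃ σ, Represents cD e fs ts σ c ∧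
      K (response (cD none) B N σ).1 (response (cD none) B N σ).2 p.1 ∧
      p.2 = senderCfg A u w (Fin.last _)
  have hout : ∀ σ c, Represents cD e fs ts σ c → ∃ (b : Bool) (l : List (Option (Action Chan D A))),
      (b = true ↔ c ∈ M.lts.final) ∧
      ((enabled (cD none) σ).map fun t => t.2.2.1) = l.map cA ∧ l.length ≤ B ∧
      response (cD none) B N σ = (Encodable.encode (b, l.map cA) + 1, Encodable.encode σ) := by
    intro σ c h
    obtain ⟨b, l, hl, hb, hl', ho⟩ := exists_output_eq one hB hcD hfs hts h
    refine ⟨b, l, hb, hl', hl, ?_⟩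
    rw [response, ho, min_eq_left (hN b l hl)]
  have hlast : ∀ a y, ¬ (RTM.sender A u w).lts.step (senderCfg A u w (Fin.last _)) a y := by
    intro a y h
    obtain ⟨h, -⟩ := sender_step_iff.1 h
    simp at h
  have hinert : ∀ {s t : U.lts.State}, U.lts.InertStar s t → ∀ i,
      (LTS.par {u} U.lts (RTM.sender A u w).lts).InertStar (s, senderCfg A u w i)
        (t, senderCfg A u w i) := fun h i => h.par sender_step_send
  have hnext : ∀ σ c a c' i k, Represents cD e fs ts σ c → (enabled (cD none) σ)[i]? = some k →
      (∃ d' m, k = ((e c.1 : ℕ), cD c.2.head, cA a, cD d', RTM.dirCode m, (e c'.1 : ℕ)) ∧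
        c'.2 = (c.2.write d').move m) →
      ∃ σ', Represents cD e fs ts σ' c' ∧
        command (cD none) B N (i + 3) (response (cD none) B N σ).2 =
          response (cD none) B N σ' := by
    rintro σ c a ⟨t, T⟩ i k h hi ⟨d', m, rfl, hT⟩
    refine ⟨next (cD none) i σ, ?_, ?_⟩
    · dsimp only at hT
      rw [hT, next, hi]
      exact represents_apply h _ _ _ _ _ _
    · exact congrArg (fun σ => response (cD none) B N (next (cD none) i σ)) (ofCode_encode σ)
  refine LTS.divBranchingBisimilar_of_inert KK ?_ ?_ ?_ ?_
  · rintro c ⟨k, y⟩ ⟨σ, h, hk, rfl⟩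
    obtain ⟨b, l, hb, -, -, hr⟩ := hout σ c h
    rw [hr] at hk
    have hf := hfinal _ _ _ hk
    constructor
    · intro hc
      refine ⟨hf.2 ⟨l.map cA, ?_⟩, rfl⟩
      rw [hb.2 hc]
    · rintro ⟨hp, -⟩
      obtain ⟨l', hl'⟩ := hf.1 hp
      have := Prod.mk.inj (Encodable.encode_injective (Nat.succ_injective hl'))
      exact hb.1 this.1
  · rintro c ⟨k, y⟩ a ⟨t, T⟩ ⟨σ, h, hk, rfl⟩ ⟨d', m, ht, hT⟩
    obtain ⟨b, l, hb, hl, hlB, hr⟩ := hout σ c h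
    obtain ⟨i, hi⟩ := List.mem_iff_getElem?.1
      ((mem_enabled hcD hts h).2 ⟨a, d', m, t, ht, rfl⟩)
    have hli : (l.map cA)[i]? = some (cA a) := by
      rw [← hl, List.getElem?_map, hi]
      rfl
    have hiB : i < B := by
      have := (List.getElem?_eq_some_iff.1 hli).1
      rw [List.length_map] at this
      omega
    obtain ⟨σ', h', hc⟩ := hnext σ c a (t, T) i _ h hi ⟨d', m, rfl, hT⟩
    have hact : Menu u one lb rb cA B (response (cD none) B N σ).1 a (i + 3) := by
      rw [hr]
      exact .act b _ i a hiB hli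
    obtain ⟨k', k'', hs, hi', hk''⟩ := hmenu _ _ _ _ _ hk hact
    rw [hc] at hk''
    refine ⟨(k', _), (k'', _), ⟨?_, .inl ⟨hs, rfl⟩⟩, hinert hi' _, σ', h', hk'', rfl⟩
    -- The action comes from `M`, which avoids `u`, so the composition does not block it.
    rintro ⟨_, rfl, d, rfl | rfl⟩
    · exact (hM _ _ _ _ _ _).1 ht
    · exact (hM _ _ _ _ _ _).2 ht
  · rintro c ⟨k, y⟩ a ⟨k', y'⟩ ⟨σ, h, hk, rfl⟩ ⟨-, ⟨hs, hy⟩ | ⟨hs, -⟩ |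
      ⟨-, _, -, d, ⟨-, hs⟩ | ⟨-, hs⟩⟩⟩
    · obtain ⟨b, l, hb, hl, hlB, hr⟩ := hout σ c h
      obtain ⟨j, hj, k'', hi', hk''⟩ := hstep _ _ _ _ _ hk hs
      obtain ⟨i, rfl, hli⟩ := hj.exists_index (congrArg Prod.fst hr)
      rw [← hl, List.getElem?_map, Option.map_eq_some_iff] at hli
      obtain ⟨x, hx, hxa⟩ := hli
      obtain ⟨a', d', m, t, ht, rfl⟩ :=
        (mem_enabled hcD hts h).1 (List.mem_of_getElem? hx)
      -- The menu records only codes of actions; injectivity identifies the action performed with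
      -- that of `M`.
      obtain rfl := hcA hxa
      obtain ⟨σ', h', hc⟩ := hnext σ c a' (t, (c.2.write d').move m) i _ h hx ⟨d', m, rfl, rfl⟩
      rw [hc] at hk''
      obtain rfl : senderCfg A u w (Fin.last _) = y' := hy
      exact ⟨_, (k'', _), ⟨d', m, ht, rfl⟩, hinert hi' _, σ', h', hk'', rfl⟩
    · exact absurd hs (hlast _ _)
    · exact absurd hs (hlast _ _)
    · exact absurd hs (hlast _ _)
  -- With output `0` the receiver can only receive along `u`, so its synchronisation with the sender
  -- is the only possible step.
  · have hread : ∀ m k i j x (hi : i + 1 < w.length + 1), K 0 m k → w[i]? = some x →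
        Menu u one lb rb cA B 0 (some (.recv u x)) j → ∃ k',
          (LTS.par {u} U.lts (RTM.sender A u w).lts).InertStar
            (k, senderCfg A u w ⟨i, by omega⟩) (k', senderCfg A u w ⟨i + 1, hi⟩) ∧
          K (command (cD none) B N j m).1 (command (cD none) B N j m).2 k' := by
      intro m k i j x hi hk hx hj
      obtain ⟨k', k'', hs, hi', hk''⟩ := hmenu _ _ _ _ _ hk hj
      refine ⟨k'', .head (par_sender_inertStep hi hx ?_ hs ?_) (hinert hi' _), hk''⟩
      · intro a s' hs'
        obtain ⟨j', hj', -⟩ := hstep _ _ _ _ _ hk hs'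
        exact hj'.recv rfl
      · intro t' ht'
        exact huniq _ _ _ _ _ _ hk (fun _ _ h h' => h.det h₁ h₂ h₃ rfl h' rfl) ht' hs
    -- After the opening bracket and `i` ones, `i + 1` symbols have been sent and the memory is `i`.
    have hcount : ∀ i (hi : i ≤ g + 1), ∃ k,
        (LTS.par {u} U.lts (RTM.sender A u w).lts).InertStar
          (U.lts.init, senderCfg A u w ⟨0, by omega⟩) (k, senderCfg A u w ⟨i + 1, by omega⟩) ∧
        K 0 i k := by
      intro i
      induction i with
      | zero =>
        intro hi
        obtain ⟨k, hk, hk'⟩ := hread 0 k₀ 0 0 (some lb) (by omega) hK₀ rfl .recvLeft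
        exact ⟨k, (hinert hk₀ _).trans hk, hk'⟩
      | succ i ih =>
        intro hi
        obtain ⟨k, hk, hk'⟩ := ih (by omega)
        have hx : w[i + 1]? = some (some one) := by
          simp only [w, RTM.message, List.getElem?_cons_succ]
          rw [List.getElem?_append_left (by simp; omega),
            List.getElem?_replicate_of_lt (by omega)]
        obtain ⟨k₁, hk₁, hk₁'⟩ := hread i k (i + 1) 1 (some one) (by omega) hk' hx .recvOne
        exact ⟨k₁, hk.trans hk₁, hk₁'⟩
    obtain ⟨k, hk, hk'⟩ := hcount (g + 1) le_rfl
    have hx : w[g + 2]? = some (some rb) := by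
      simp [w, RTM.message]
    obtain ⟨k₁, hk₁, hk₁'⟩ := hread (g + 1) k (g + 2) 2 (some rb) (by omega) hk' hx .recvRight
    refine ⟨_, hk.trans hk₁, load g, represents_load hg, hk₁', ?_⟩
    exact congrArg (senderCfg A u w) (Fin.ext (by simp [hw]))

end Universal

end ReactiveTM

/-- For all finite alphabets, codings of them, and every bound `B`, there is a reactive Turing machine
that is universal up to `B`. -/
theorem mainTheorem4 {Chan D A : Type*}
    [Finite Chan] [Finite D] [Finite A]
    (u : Chan) (one lb rb : D) (h₁ : one ≠ lb) (h₂ : one ≠ rb) (h₃ : lb ≠ rb)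
    (cA : Option (ReactiveTM.Action Chan D A) → ℕ) (hcA : Function.Injective cA)
    (cD : Option D → ℕ) (hcD : Function.Injective cD) (B : ℕ) :
    ∃ U : ReactiveTM.RTM.{0} (ReactiveTM.Action Chan D A) D,
      ReactiveTM.RTM.UniversalUpTo.{w} u one lb rb cA cD B U :=
  ReactiveTM.exists_universalUpTo h₁ h₂ h₃ hcA hcD
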